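/- Let $k$ be an algebraically closed field. A power series $f\in k[[x]]$ that is algebraic over $k[x]$ has a minimal polynomial: a generator of the kernel of $k[x,T]\to k[[x]]$, $P(x,T)\mapsto P(x,f)$; it is unique up to a factor in $k^*$. Let $\mathcal I(d,h)$ be the set of algebraic power series $f$ with $f(0)=0$ whose minimal polynomial $P$ satisfies $\deg_T P\le d$, $\deg_x P\le h$, $P(0,0)=0$ and $\frac{\partial P}{\partial T}(0,0)\ne 0$. For $d,h\ge 1$ identify $\mathbb A_k^{dh+d+h-1}$ with the set of polynomials $P_a(x,T)=T+\sum a_{i,j}x^iT^j$, the sum being over $0\le i\le h$, $0\le j\le d$, $(i,j)\ne(0,0),(0,1)$, that is, with the set of polynomials $P$ such that $P(0,0)=0$, $\frac{\partial P}{\partial T}(0,0)=1$, $\deg_xP\le h$, $\deg_TP\le d$. Let $F$ be the unique power series in $x$, without constant term and with coefficients in the polynomial ring $k[A_{i,j}]$, such that $F+\sum A_{i,j}x^iF^j=0$, and let $f_{d,h}(a)\in k[[x]]$ be the series obtained from $F$ by setting $A_{i,j}=a_{i,j}$. 1) Let $d,h\ge1$. Then $f_{d,h}(a)\in\mathcal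 I(d,h)$ for every $a\in\mathbb A_k^{dh+d+h-1}$. Sending $f\in\mathcal I(d,h)$ to the coefficient vector of its minimal polynomial, normalised so that the coefficient of $x^0T^1$ is $1$, defines an injective map $\psi_{d,h}:\mathcal I(d,h)\to\mathbb A_k^{dh+d+h-1}$. Its image is the set $\mathcal C_{d,h}$ of all $a$ such that $P_a$ is irreducible in $k[x,T]$; this set is constructible and contains a nonempty Zariski-open subset of $\mathbb A_k^{dh+d+h-1}$. Moreover $f_{d,h}\circ\psi_{d,h}=\mathrm{id}_{\mathcal I(d,h)}$. 2) Let $d'\ge d\geq 1$ and $h'\ge h\geq 1$. Let $\pi^{(2)}:\mathbb A_k^{d'h'+d'+h'-1}\to\mathbb A_k^{dh+d+h-1}$ be the projection that forgets the coordinates $a_{i,j}$ with $i>h$ or $j>d$, let $\varepsilon:\mathbb A_k^{dh+d+h-1}\to\mathbb A_k^{d'h'+d'+h'-1}$ be extension by zero, and let $\pi^{(1)}=f_{d,h}\circ\pi^{(2)}\circ\psi_{d',h'}:\mathcal I(d',h')\to\mathcal I(d,h)$. Then: (a) $\mathcal I(d,h)\subset\mathcal I(d',h')$, $\ \psi_{d',h'}|_{\mathcal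 I(d,h)}=\varepsilon\circ\psi_{d,h}$, $\ f_{d',h'}\circ\varepsilon=f_{d,h}$, and $\pi^{(1)}$ is the identity on $\mathcal I(d,h)$. (b) For $f\in\mathcal I(d',h')$ one has $\psi_{d,h}(\pi^{(1)}(f))=\pi^{(2)}(\psi_{d',h'}(f))$ if and only if the polynomial with coefficient vector $\pi^{(2)}(\psi_{d',h'}(f))$ is irreducible. The image under $\psi_{d',h'}$ of the set of all $f$ for which this equality holds contains a nonempty Zariski-open subset of $\mathbb A_k^{d'h'+d'+h'-1}$; that is, $\psi_{d,h}\circ\pi^{(1)}=\pi^{(2)}\circ\psi_{d',h'}$ as rational maps. -/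

import Mathlib

open Polynomial PowerSeries Topology

/-! ### Algebraic power series, degree, height

A polynomial `P(x, T)` is an element of `k[X][X]`: the inner variable is `x`, the outer one is `T`.
The value `P(x, f)` at a power series `f` is `aeval f P`. -/

/-- `P` generates the kernel of `k[x,T] → k⟦x⟧`, `P(x,T) ↦ P(x,f)`. -/
def IsMinimalPolynomial {k : Type*} [Field k] (f : k⟦X⟧) (P : k[X][X]) : Prop :=
  RingHom.ker (aeval f : k[X][X] →ₐ[k[X]] k⟦X⟧) = Ideal.span {P}

/-- The height of `P`: the maximum of the degrees in `x` of its coefficients. -/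
noncomputable def polyHeight {k : Type*} [Field k] (P : k[X][X]) : ℕ :=
  P.support.sup fun j => (P.coeff j).natDegree

/-- `P(0,0) = 0` and `∂P/∂T(0,0) ≠ 0`. -/
def SatisfiesIFT {k : Type*} [Field k] (P : k[X][X]) : Prop :=
  P.evalEval 0 0 = 0 ∧ (derivative P).evalEval 0 0 ≠ 0

/-- The algebraic power series of degree at most `d` and height at most `h`. -/
def algSeries (k : Type*) [Field k] (d h : ℕ) : Set k⟦X⟧ :=
  {f | IsAlgebraic k[X] f ∧ ∃ P, IsMinimalPolynomial f P ∧ P.natDegree ≤ d ∧ polyHeight P ≤ h}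

/-- The elements of `algSeries k d h` that vanish at `0`. -/
def algSeriesZero (k : Type*) [Field k] (d h : ℕ) : Set k⟦X⟧ :=
  {f | f ∈ algSeries k d h ∧ PowerSeries.constantCoeff f = 0}

/-- `I(d,h)`: the elements of `algSeriesZero k d h` whose minimal polynomial satisfies the
hypothesis of the implicit function theorem. -/
def iftSeries (k : Type*) [Field k] (d h : ℕ) : Set k⟦X⟧ :=
  {f | f ∈ algSeriesZero k d h ∧ ∃ P, IsMinimalPolynomial f P ∧ SatisfiesIFT P}

/-! ### The affine space of normalised polynomials -/

/-- The exponents `(i, j)` of the monomials `x^i T^j` with `i ≤ h`, `j ≤ d`, other than `(0,0)`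
and `(0,1)`. -/
def coeffIndex (d h : ℕ) : Finset (ℕ × ℕ) :=
  (Finset.range (h + 1) ×ˢ Finset.range (d + 1)) \ {(0, 0), (0, 1)}

/-- The points with values in `R` of the affine space with one coordinate `a_{i,j}` for each
`(i, j)` in `coeffIndex d h`. -/
abbrev CoeffSpace (d h : ℕ) (R : Type*) : Type _ := coeffIndex d h → R

/-- The polynomial `T + ∑ a_{i,j} x^i T^j`. -/
noncomputable def polyOf {d h : ℕ} {R : Type*} [CommRing R] (a : CoeffSpace d h R) : R[X][X] :=
  Polynomial.X + ∑ p : coeffIndex d h,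
    Polynomial.C (Polynomial.C (a p) * Polynomial.X ^ p.1.1) * Polynomial.X ^ p.1.2

/-- The projection that forgets the coordinates with `i > h` or `j > d`. -/
def coeffProj {d h d' h' : ℕ} {R : Type*} (hd : d ≤ d') (hh : h ≤ h')
    (a : CoeffSpace d' h' R) : CoeffSpace d h R :=
  fun p => a ⟨p.1, by
    have hp := p.2
    simp only [coeffIndex, Finset.mem_sdiff, Finset.mem_product, Finset.mem_range] at hp ⊢
    exact ⟨⟨by omega, by omega⟩, hp.2⟩⟩

/-- Extension by zero of a coefficient vector. -/
def coeffExt {d h : ℕ} (d' h' : ℕ) {R : Type*} [Zero R]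
    (a : CoeffSpace d h R) : CoeffSpace d' h' R :=
  fun p => if hp : p.1 ∈ coeffIndex d h then a ⟨p.1, hp⟩ else 0

/-- The Zariski topology on affine space: the principal open sets `{a | q(a) ≠ 0}` form a basis. -/
abbrev zariskiTopology (σ k : Type*) [Field k] : TopologicalSpace (σ → k) :=
  TopologicalSpace.generateFrom
    {U | ∃ q : MvPolynomial σ k, U = {a | MvPolynomial.eval a q ≠ 0}}

/-- Zariski open subsets of affine space. -/
def IsZariskiOpen {σ k : Type*} [Field k] (s : Set (σ → k)) : Prop :=
  IsOpen[zariskiTopology σ k] s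

/-- Constructible subsets of affine space, for the Zariski topology. -/
def IsZariskiConstructible {σ k : Type*} [Field k] (s : Set (σ → k)) : Prop :=
  @Topology.IsConstructible (σ → k) (zariskiTopology σ k) s

/-! ### The map `ψ` -/

/-- The vector of coefficients of the minimal polynomial of `f`, normalised so that the coefficient
of `x^0 T^1` is `1` (two minimal polynomials differ by a nonzero constant, so the choice of one
does not matter). -/
noncomputable def psi {k : Type*} [Field k] {d h : ℕ} (f : iftSeries k d h) : CoeffSpace d h k :=
  fun p =>
    ((Classical.choose f.2.2).coeff p.1.2).coeff p.1.1 /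
      ((Classical.choose f.2.2).coeff 1).coeff 0

/-! ### The universal root and the map `f_{d,h}` -/

/-- The implicit function theorem for power series over a commutative ring. -/
theorem existsUnique_root {R : Type*} [CommRing R] (Q : R⟦X⟧[X])
    (h0 : PowerSeries.X ∣ Q.eval 0) (h1 : PowerSeries.X ∣ 1 - (derivative Q).eval 0) :
    ∃! F : R⟦X⟧, PowerSeries.constantCoeff F = 0 ∧ Q.eval F = 0 := by
  have hder : ∀ F : R⟦X⟧, PowerSeries.X ∣ F → PowerSeries.X ∣ 1 - (derivative Q).eval F := by
    intro F hF
    have h2 : PowerSeries.X ∣ (derivative Q).eval F - (derivative Q).eval 0 :=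
      (by simpa using hF : PowerSeries.X ∣ F - 0).trans (Polynomial.sub_dvd_eval_sub F 0 _)
    have h3 := dvd_sub h1 h2
    convert h3 using 1
    ring
  let G : ℕ → R⟦X⟧ := fun n => (fun F => F - Q.eval F)^[n] 0
  have hG : ∀ n, G (n + 1) = G n - Q.eval (G n) := fun n => by
    simp only [G, Function.iterate_succ_apply']
  have key : ∀ n, PowerSeries.X ∣ G n ∧ PowerSeries.X ^ (n + 1) ∣ Q.eval (G n) := by
    intro n
    induction n with
    | zero => simpa [G] using h0
    | succ n ih =>
      obtain ⟨hx, hq⟩ := ih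
      have hq1 : PowerSeries.X ∣ Q.eval (G n) := (dvd_pow_self _ (by omega)).trans hq
      refine ⟨by rw [hG]; exact dvd_sub hx hq1, ?_⟩
      obtain ⟨c, hc⟩ := Polynomial.binomExpansion Q (G n) (-(Q.eval (G n)))
      rw [hG, sub_eq_add_neg, hc]
      have e : Q.eval (G n) + (derivative Q).eval (G n) * -(Q.eval (G n))
          + c * (-(Q.eval (G n))) ^ 2 =
          Q.eval (G n) * (1 - (derivative Q).eval (G n) + c * Q.eval (G n)) := by ring
      rw [e, pow_succ]
      exact mul_dvd_mul hq (dvd_add (hder _ hx) (hq1.mul_left _))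
  have cau : ∀ n m, PowerSeries.X ^ (n + 1) ∣ G (n + m) - G n := by
    intro n m
    induction m with
    | zero => simp
    | succ m ih =>
      have h2 : PowerSeries.X ^ (n + 1) ∣ Q.eval (G (n + m)) :=
        (pow_dvd_pow _ (by omega)).trans (key (n + m)).2
      have h3 := dvd_sub ih h2
      rw [← add_assoc, hG]
      convert h3 using 1
      ring
  let F : R⟦X⟧ := PowerSeries.mk fun n => PowerSeries.coeff n (G n)
  have hF : ∀ n, PowerSeries.X ^ (n + 1) ∣ F - G n := by
    intro n
    rw [PowerSeries.X_pow_dvd_iff]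
    intro m hm
    obtain ⟨r, rfl⟩ := Nat.exists_eq_add_of_le (Nat.lt_succ_iff.mp hm)
    have h2 := (PowerSeries.X_pow_dvd_iff.mp (cau m r)) m (by omega)
    rw [map_sub, sub_eq_zero] at h2
    simp [F, h2]
  refine ⟨F, ⟨?_, ?_⟩, ?_⟩
  · rw [← PowerSeries.coeff_zero_eq_constantCoeff_apply]
    simp [F, G]
  · ext n
    have h2 : PowerSeries.X ^ (n + 1) ∣ Q.eval F := by
      have h3 := dvd_add ((hF n).trans (Polynomial.sub_dvd_eval_sub F (G n) Q)) (key n).2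
      simpa using h3
    simpa using (PowerSeries.X_pow_dvd_iff.mp h2) n (by omega)
  · rintro H ⟨hH0, hH⟩
    have hx : PowerSeries.X ∣ F := by
      have := dvd_add ((dvd_pow_self _ (by omega)).trans (hF 0)) (key 0).1
      simpa using this
    have hxH : PowerSeries.X ∣ H := PowerSeries.X_dvd_iff.mpr hH0
    have hQF : Q.eval F = 0 := by
      ext n
      have h2 : PowerSeries.X ^ (n + 1) ∣ Q.eval F := by
        have h3 := dvd_add ((hF n).trans (Polynomial.sub_dvd_eval_sub F (G n) Q)) (key n).2
        simpa using h3
      simpa using (PowerSeries.X_pow_dvd_iff.mp h2) n (by omega)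
    obtain ⟨c, hc⟩ := Polynomial.binomExpansion Q F (H - F)
    rw [add_sub_cancel, hH, hQF, zero_add] at hc
    have e : (H - F) * ((derivative Q).eval F + c * (H - F)) = 0 := by rw [hc]; ring
    have hu : IsUnit ((derivative Q).eval F + c * (H - F)) := by
      rw [PowerSeries.isUnit_iff_constantCoeff]
      have h4 := PowerSeries.X_dvd_iff.mp (hder F hx)
      have h5 := PowerSeries.X_dvd_iff.mp (dvd_sub hxH hx)
      rw [map_sub, map_one, sub_eq_zero] at h4
      rw [map_add, map_mul, h5, ← h4]
      simp
    exact sub_eq_zero.mp (hu.mul_left_eq_zero.mp e)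

/-- The polynomial `T + ∑ a_{i,j} x^i T^j` has a unique power series root without constant term. -/
theorem existsUnique_root_polyOf {d h : ℕ} {R : Type*} [CommRing R] (a : CoeffSpace d h R) :
    ∃! F : R⟦X⟧, PowerSeries.constantCoeff F = 0 ∧ aeval F (polyOf a) = 0 := by
  have hi : ∀ p : coeffIndex d h, p.1.2 ≤ 1 → p.1.1 ≠ 0 := by
    rintro ⟨⟨i, j⟩, hp⟩ hj rfl
    simp only [coeffIndex, Finset.mem_sdiff, Finset.mem_insert, Finset.mem_singleton,
      Prod.mk.injEq, true_and] at hp hj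
    omega
  have hc : ∀ n ≤ 1, Polynomial.X ∣ (polyOf a).coeff n - (Polynomial.X : R[X][X]).coeff n := by
    intro n hn
    simp only [polyOf, Polynomial.coeff_add, add_sub_cancel_left, Polynomial.finsetSum_coeff,
      Polynomial.coeff_C_mul_X_pow]
    refine Finset.dvd_sum fun p _ => ?_
    split_ifs with hp
    · exact (dvd_pow_self _ (hi p (hp ▸ hn))).mul_left _
    · exact dvd_zero _
  have hX : algebraMap R[X] R⟦X⟧ Polynomial.X = PowerSeries.X := Polynomial.coe_X
  have key := existsUnique_root ((polyOf a).map (algebraMap R[X] R⟦X⟧)) ?_ ?_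
  · simpa only [Polynomial.eval_map_algebraMap] using key
  · have h2 := map_dvd (algebraMap R[X] R⟦X⟧) (hc 0 (by norm_num))
    rw [hX] at h2
    rw [← Polynomial.coeff_zero_eq_eval_zero, Polynomial.coeff_map]
    simpa using h2
  · have h2 := map_dvd (algebraMap R[X] R⟦X⟧) (hc 1 le_rfl)
    rw [hX, ← dvd_neg, ← map_neg, neg_sub, Polynomial.coeff_X_one, map_sub, map_one] at h2
    rw [← Polynomial.coeff_zero_eq_eval_zero, Polynomial.coeff_derivative, Polynomial.coeff_map]
    simpa using h2

/-- The universal root: the unique power series `F` without constant term, with coefficients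
polynomials in indeterminates `A_{i,j}`, such that `F + ∑ A_{i,j} x^i F^j = 0`. -/
noncomputable def univRoot (k : Type*) [Field k] (d h : ℕ) :
    (MvPolynomial (coeffIndex d h) k)⟦X⟧ :=
  Classical.choose (existsUnique_root_polyOf
    (fun p : coeffIndex d h => (MvPolynomial.X p : MvPolynomial (coeffIndex d h) k))).exists

/-- The map `f_{d,h}`: specialisation of the coefficients of the universal root at a point. -/
noncomputable def rootMap {k : Type*} [Field k] {d h : ℕ} (a : CoeffSpace d h k) : k⟦X⟧ :=
  PowerSeries.map (MvPolynomial.eval a) (univRoot k d h)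

/-!
Since `∂P_a/∂T(0,0) = 1`, the implicit function theorem makes `f_{d,h}(a)` the only series without
constant term annihilated by `P_a` (`eq_rootMap`). An irreducible polynomial that annihilates a
series generates all annihilating polynomials, by Gauss's lemma
(`Irreducible.isMinimalPolynomial`). The minimal polynomial of `f_{d,h}(a)` is thus an irreducible
factor of `P_a`; it obeys the same degree bounds and, having no constant term, inherits the
condition on `∂/∂T` (`rootMap_mem_iftSeries`). Together with the uniqueness of a minimal polynomial
normalised at `x^0 T^1` this gives everything about `ψ` and `f_{d,h}` apart from the topology of
the irreducible locus.

For the topology no elimination theory is needed. If `P_a` has degree at most `p` and height at most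
`q`, and if no nonzero polynomial within these bounds, and strictly below one of them, annihilates
`f_{d,h}(a)`, then the minimal polynomial has the bidegree of `P_a`, so `P_a` is irreducible; and
conversely an irreducible `P_a` of bidegree exactly `(p, q)` has this property
(`setOf_irreducible_polyOf_eq`). The property says that finitely many products `x^i f^j` are
linearly independent over `k`. As their coefficients are polynomials in `a`, this is an open
condition (`isZariskiOpen_linearIndependent`). The irreducible locus is therefore a finite union of
locally closed sets, and affine space is Noetherian, so it is constructible. For
`(p, q) = (d, h)` the degree bounds are automatic and the stratum is open; it is nonempty because of
`T + x^h (1 + T^d)`, which is Eisenstein at `T` as a polynomial in `x`. The open set of the last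
statement is the intersection of this open set for `(d', h')` with the preimage of the one for
`(d, h)`, nonempty as affine space over an infinite field is irreducible.
-/

/-! ### Bivariate polynomials: height, irreducibility, minimal polynomials -/

theorem coeff_coeff_swap {k : Type*} [Field k] (P : k[X][X]) (i j : ℕ) :
    ((Bivariate.swap P).coeff i).coeff j = (P.coeff j).coeff i := by
  induction P using Polynomial.induction_on' with
  | add p q hp hq => simp [hp, hq]
  | monomial n f =>
    induction f using Polynomial.induction_on' with
    | add p q hp hq => simp only [map_add, Polynomial.coeff_add, hp, hq]
    | monomial m r =>
      rw [Bivariate.swap_monomial_monomial]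
      simp only [Polynomial.coeff_monomial]
      split_ifs <;> simp_all [Polynomial.coeff_monomial]

theorem polyHeight_le_iff {k : Type*} [Field k] {P : k[X][X]} {h : ℕ} :
    polyHeight P ≤ h ↔ ∀ i j, h < i → (P.coeff j).coeff i = 0 := by
  rw [polyHeight, Finset.sup_le_iff]
  constructor
  · intro H i j hi
    by_cases hj : j ∈ P.support
    · exact coeff_eq_zero_of_natDegree_lt ((H j hj).trans_lt hi)
    · rw [notMem_support_iff.mp hj, Polynomial.coeff_zero]
  · intro H j _
    exact natDegree_le_iff_coeff_eq_zero.mpr fun i hi => H i j hi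

/-- The height is the degree in the other variable, hence additive on products. -/
theorem polyHeight_eq_natDegree_swap {k : Type*} [Field k] (P : k[X][X]) :
    polyHeight P = (Bivariate.swap P).natDegree := by
  refine eq_of_forall_ge_iff fun h => ?_
  rw [polyHeight_le_iff, natDegree_le_iff_coeff_eq_zero]
  simp only [Polynomial.ext_iff, coeff_coeff_swap, Polynomial.coeff_zero]
  exact forall_congr' fun i => ⟨fun H hi j => H j hi, fun H j hi => H hi j⟩

theorem polyHeight_mul {k : Type*} [Field k] {P Q : k[X][X]} (hP : P ≠ 0) (hQ : Q ≠ 0) :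
    polyHeight (P * Q) = polyHeight P + polyHeight Q := by
  simp only [polyHeight_eq_natDegree_swap, map_mul]
  exact natDegree_mul (by simpa using hP) (by simpa using hQ)

theorem polyHeight_le_of_dvd {k : Type*} [Field k] {P Q : k[X][X]} (h : P ∣ Q) (hQ : Q ≠ 0) :
    polyHeight P ≤ polyHeight Q := by
  obtain ⟨R, rfl⟩ := h
  rw [polyHeight_mul (left_ne_zero_of_mul hQ) (right_ne_zero_of_mul hQ)]
  exact Nat.le_add_right _ _

theorem isUnit_of_natDegree_eq_zero_of_polyHeight_eq_zero {k : Type*} [Field k] {P : k[X][X]}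
    (hP : P ≠ 0) (hd : P.natDegree = 0) (hh : polyHeight P = 0) : IsUnit P := by
  obtain ⟨c, rfl⟩ := natDegree_eq_zero.mp hd
  have hc : c.natDegree = 0 := by
    refine Nat.le_zero.mp (natDegree_le_iff_coeff_eq_zero.mpr fun i hi => ?_)
    simpa using polyHeight_le_iff.mp hh.le i 0 hi
  obtain ⟨b, rfl⟩ := natDegree_eq_zero.mp hc
  have hb : b ≠ 0 := by rintro rfl; simp at hP
  exact ((isUnit_iff_ne_zero.mpr hb).map Polynomial.C).map Polynomial.C

theorem evalEval_zero_zero {k : Type*} [Field k] (P : k[X][X]) :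
    P.evalEval 0 0 = (P.coeff 0).coeff 0 := by
  rw [evalEval, Polynomial.C_0, ← coeff_zero_eq_eval_zero, ← coeff_zero_eq_eval_zero]

theorem derivative_evalEval_zero_zero {k : Type*} [Field k] (P : k[X][X]) :
    (derivative P).evalEval 0 0 = (P.coeff 1).coeff 0 := by
  rw [evalEval_zero_zero, Polynomial.coeff_derivative]
  simp

theorem algebraMap_polynomial_powerSeries_injective (k : Type*) [Field k] :
    Function.Injective (algebraMap k[X] k⟦X⟧) :=
  Polynomial.coe_injective k

/-- Polynomials that become coprime over the fraction field have no common root. -/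
theorem aeval_ne_zero_of_isCoprime_map {A B : Type*} (K L : Type*) [CommRing A] [CommRing B]
    [IsDomain B] [Algebra A B] [Field K] [Algebra A K] [IsFractionRing A K]
    [Field L] [Algebra B L] [IsFractionRing B L]
    (hinj : Function.Injective (algebraMap A B)) {P Q : A[X]} {f : B}
    (h : IsCoprime (P.map (algebraMap A K)) (Q.map (algebraMap A K)))
    (hP : aeval f P = 0) : aeval f Q ≠ 0 := by
  intro hQ
  have hinj' : Function.Injective ((algebraMap B L).comp (algebraMap A B)) :=
    (IsFractionRing.injective B L).comp hinj
  have hev : ∀ S : A[X], aeval f S = 0 → eval₂ (IsFractionRing.lift hinj' : K →+* L)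
      (algebraMap B L f) (S.map (algebraMap A K)) = 0 := by
    intro S hS
    have hφ : (IsFractionRing.lift hinj' : K →+* L).comp (algebraMap A K) =
        (algebraMap B L).comp (algebraMap A B) :=
      RingHom.ext fun c => IsFractionRing.lift_algebraMap hinj' c
    rw [eval₂_map, hφ, ← Polynomial.hom_eval₂, ← aeval_def, hS, map_zero]
  obtain ⟨u, v, huv⟩ := h
  have h2 := congrArg (eval₂ (IsFractionRing.lift hinj' : K →+* L) (algebraMap B L f)) huv
  rw [eval₂_add, eval₂_mul, eval₂_mul, hev P hP, hev Q hQ, eval₂_one, mul_zero, mul_zero,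
    add_zero] at h2
  exact zero_ne_one h2

/-- Irreducible annihilating polynomials are minimal: if `P` did not divide an annihilating `Q`,
then by Gauss's lemma `P` and `Q` would be coprime over `k(x)`. -/
theorem Irreducible.isMinimalPolynomial {k : Type*} [Field k] {f : k⟦X⟧} {P : k[X][X]}
    (hP : Irreducible P) (hf : aeval f P = 0) : IsMinimalPolynomial f P := by
  have hinj := algebraMap_polynomial_powerSeries_injective k
  have hdeg : P.natDegree ≠ 0 := by
    intro h0
    obtain ⟨c, rfl⟩ := natDegree_eq_zero.mp h0
    rw [aeval_C, map_eq_zero_iff _ hinj] at hf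
    exact hP.ne_zero (by rw [hf, Polynomial.C_0])
  have hprim := hP.isPrimitive hdeg
  ext Q
  rw [RingHom.mem_ker, Ideal.mem_span_singleton]
  refine ⟨fun hQ => ?_, fun ⟨R, hR⟩ => ?_⟩
  · have hPK := (hprim.irreducible_iff_irreducible_map_fraction_map (K := RatFunc k)).mp hP
    rcases hPK.isCoprime_or_dvd (Q.map (algebraMap k[X] (RatFunc k))) with h | h
    · exact absurd hQ (aeval_ne_zero_of_isCoprime_map (RatFunc k) (FractionRing k⟦X⟧) hinj h hf)
    · exact hprim.dvd_of_fraction_map_dvd_fraction_map h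
  · change aeval f Q = 0
    rw [hR, map_mul, hf, zero_mul]

theorem IsMinimalPolynomial.aeval_eq_zero {k : Type*} [Field k] {f : k⟦X⟧} {P : k[X][X]}
    (h : IsMinimalPolynomial f P) : aeval f P = 0 := by
  have h2 : P ∈ RingHom.ker (aeval f : k[X][X] →ₐ[k[X]] k⟦X⟧) := by
    rw [h]; exact Ideal.mem_span_singleton_self P
  exact h2

theorem IsMinimalPolynomial.dvd {k : Type*} [Field k] {f : k⟦X⟧} {P Q : k[X][X]}
    (h : IsMinimalPolynomial f P) (hQ : aeval f Q = 0) : P ∣ Q := by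
  have h2 : Q ∈ RingHom.ker (aeval f : k[X][X] →ₐ[k[X]] k⟦X⟧) := hQ
  rwa [h, Ideal.mem_span_singleton] at h2

theorem IsMinimalPolynomial.irreducible {k : Type*} [Field k] {f : k⟦X⟧} {P : k[X][X]}
    (h : IsMinimalPolynomial f P) (hP : P ≠ 0) : Irreducible P := by
  have h2 := RingHom.ker_isPrime (aeval f : k[X][X] →ₐ[k[X]] k⟦X⟧)
  rw [h, Ideal.span_singleton_prime hP] at h2
  exact h2.irreducible

theorem IsMinimalPolynomial.associated {k : Type*} [Field k] {f : k⟦X⟧} {P Q : k[X][X]}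
    (hP : IsMinimalPolynomial f P) (hQ : IsMinimalPolynomial f Q) : Associated P Q :=
  associated_of_dvd_dvd (hP.dvd hQ.aeval_eq_zero) (hQ.dvd hP.aeval_eq_zero)

theorem IsMinimalPolynomial.congr {k : Type*} [Field k] {f : k⟦X⟧} {P Q : k[X][X]}
    (hP : IsMinimalPolynomial f P) (h : Associated P Q) : IsMinimalPolynomial f Q := by
  rw [IsMinimalPolynomial, hP, Ideal.span_singleton_eq_span_singleton]
  exact h

/-- Associated polynomials with the same nonzero linear coefficient at the origin agree. -/
theorem eq_of_associated_of_coeff_eq {k : Type*} [Field k] {P Q : k[X][X]} (h : Associated P Q)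
    (hPQ : (P.coeff 1).coeff 0 = (Q.coeff 1).coeff 0) (hP : (P.coeff 1).coeff 0 ≠ 0) :
    P = Q := by
  obtain ⟨u, rfl⟩ := h
  obtain ⟨v, hv, huv⟩ := Polynomial.isUnit_iff.mp u.isUnit
  obtain ⟨w, -, hw⟩ := Polynomial.isUnit_iff.mp hv
  rw [← huv, ← hw, Polynomial.coeff_mul_C, Polynomial.coeff_mul_C, eq_comm,
    mul_eq_left₀ hP] at hPQ
  rw [← huv, ← hw, hPQ, Polynomial.C_1, Polynomial.C_1, mul_one]

/-- Some irreducible factor of an annihilating polynomial annihilates. -/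
theorem exists_irreducible_dvd_aeval_eq_zero {k : Type*} [Field k] {f : k⟦X⟧} {P : k[X][X]}
    (hP : P ≠ 0) (hf : aeval f P = 0) : ∃ Q, Irreducible Q ∧ Q ∣ P ∧ aeval f Q = 0 := by
  induction P using WfDvdMonoid.induction_on_irreducible with
  | zero => exact absurd rfl hP
  | unit u hu => exact absurd hf (hu.map (aeval f : k[X][X] →ₐ[k[X]] k⟦X⟧)).ne_zero
  | mul a i ha hi ih =>
    rw [map_mul, mul_eq_zero] at hf
    rcases hf with hf | hf
    · exact ⟨i, hi, dvd_mul_right _ _, hf⟩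
    · obtain ⟨Q, h1, h2, h3⟩ := ih ha hf
      exact ⟨Q, h1, h2.mul_left _, h3⟩

/-- A series without constant term kills the constant term of its annihilating polynomials. -/
theorem coeff_zero_coeff_zero_eq_zero {k : Type*} [Field k] {f : k⟦X⟧} {P : k[X][X]}
    (hf : PowerSeries.constantCoeff f = 0) (hP : aeval f P = 0) : (P.coeff 0).coeff 0 = 0 := by
  have h1 : PowerSeries.X ∣ aeval f P - algebraMap k[X] k⟦X⟧ (P.coeff 0) := by
    have h2 := Polynomial.sub_dvd_eval_sub f 0 (P.map (algebraMap k[X] k⟦X⟧))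
    rw [sub_zero, ← coeff_zero_eq_eval_zero, Polynomial.coeff_map, eval_map_algebraMap] at h2
    exact (PowerSeries.X_dvd_iff.mpr hf).trans h2
  rw [hP, zero_sub, dvd_neg, PowerSeries.X_dvd_iff] at h1
  rw [← Polynomial.constantCoeff_coe]
  exact h1

/-- `T + x^h (1 + T^d)` is irreducible: as a polynomial in `x` over `k[T]` it is Eisenstein
at `T`. -/
theorem irreducible_X_add_pow_mul {k : Type*} [Field k] {d h : ℕ} (hd : 1 ≤ d) (hh : 1 ≤ h) :
    Irreducible (Polynomial.X +
      Polynomial.C (Polynomial.X ^ h) * (1 + Polynomial.X ^ d) : k[X][X]) := by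
  have hd0 : d ≠ 0 := by omega
  have hh0 : h ≠ 0 := by omega
  rw [← MulEquiv.irreducible_iff (Bivariate.swap (R := k))]
  have hsw : Bivariate.swap (Polynomial.X +
      Polynomial.C (Polynomial.X ^ h) * (1 + Polynomial.X ^ d) : k[X][X]) =
      Polynomial.C (1 + Polynomial.X ^ d) * Polynomial.X ^ h + Polynomial.C Polynomial.X := by
    simp only [map_add, map_mul, map_pow, map_one, Bivariate.swap_X, Bivariate.swap_Y]
    ring
  have hlc : (1 + Polynomial.X ^ d : k[X]) ≠ 0 := fun H => by
    simpa [hd0.symm, hd0] using congrArg (Polynomial.eval 0) H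
  have hnd : (Polynomial.C (1 + Polynomial.X ^ d) * Polynomial.X ^ h +
      Polynomial.C Polynomial.X : k[X][X]).natDegree = h := by
    rw [natDegree_add_C, natDegree_C_mul_X_pow h _ hlc]
  have hXdvd : ¬ (Polynomial.X : k[X]) ∣ 1 + Polynomial.X ^ d := by
    rw [Polynomial.X_dvd_iff]
    simp [hd0.symm, Polynomial.coeff_X_pow]
  have hcoeff : ∀ n, (Polynomial.C (1 + Polynomial.X ^ d) * Polynomial.X ^ h +
      Polynomial.C Polynomial.X : k[X][X]).coeff n =
      (if n = h then 1 + Polynomial.X ^ d else 0) + if n = 0 then Polynomial.X else 0 := fun n => by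
    rw [Polynomial.coeff_add, Polynomial.coeff_C_mul_X_pow, Polynomial.coeff_C]
  rw [hsw]
  refine irreducible_of_eisenstein_criterion (P := Ideal.span {Polynomial.X})
    ((Ideal.span_singleton_prime Polynomial.X_ne_zero).mpr Polynomial.prime_X) ?_ ?_ ?_ ?_ ?_
  · rw [Ideal.mem_span_singleton, leadingCoeff, hnd, hcoeff, if_pos rfl, if_neg hh0, add_zero]
    exact hXdvd
  · intro n hn
    have hn' : n ≠ h := by
      rintro rfl
      rw [degree_eq_natDegree (by
        rintro H
        rw [H] at hnd
        exact hh0 (by simpa using hnd.symm)), hnd] at hn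
      exact lt_irrefl _ hn
    rw [Ideal.mem_span_singleton, hcoeff, if_neg hn', zero_add]
    split_ifs <;> simp
  · rw [← natDegree_pos_iff_degree_pos, hnd]
    exact hh
  · rw [Ideal.span_singleton_pow, Ideal.mem_span_singleton, Polynomial.X_pow_dvd_iff, hcoeff,
      if_neg hh0.symm, if_pos rfl, zero_add]
    intro H
    simpa using H 1 (by norm_num)
  · intro r hr
    have h0 := (Polynomial.C_dvd_iff_dvd_coeff r _).mp hr 0
    have h1 := (Polynomial.C_dvd_iff_dvd_coeff r _).mp hr h
    rw [hcoeff, if_neg hh0.symm, if_pos rfl, zero_add] at h0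
    rw [hcoeff, if_pos rfl, if_neg hh0, add_zero] at h1
    exact isUnit_of_dvd_one ((dvd_add_left (h0.trans (dvd_pow_self _ hd0))).mp h1)

/-! ### The Zariski topology on affine space -/

theorem isZariskiOpen_of_forall_exists {σ k : Type*} [Field k] {U : Set (σ → k)}
    (h : ∀ a ∈ U, ∃ q : MvPolynomial σ k, MvPolynomial.eval a q ≠ 0 ∧
      ∀ b, MvPolynomial.eval b q ≠ 0 → b ∈ U) : IsZariskiOpen U := by
  choose! q hq hqU using h
  have hU : U = ⋃ a ∈ U, {b | MvPolynomial.eval b (q a) ≠ 0} := by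
    ext b
    simp only [Set.mem_iUnion]
    exact ⟨fun hb => ⟨b, hb, hq b hb⟩, fun ⟨a, ha, hb⟩ => hqU a ha b hb⟩
  rw [hU]
  let _ := zariskiTopology σ k
  exact isOpen_biUnion fun a _ => TopologicalSpace.isOpen_generateFrom_of_mem ⟨q a, rfl⟩

theorem IsZariskiOpen.exists_eval_ne_zero {σ k : Type*} [Field k] {U : Set (σ → k)}
    (hU : IsZariskiOpen U) {a : σ → k} (ha : a ∈ U) :
    ∃ q : MvPolynomial σ k, MvPolynomial.eval a q ≠ 0 ∧
      ∀ b, MvPolynomial.eval b q ≠ 0 → b ∈ U := by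
  have hU' : TopologicalSpace.GenerateOpen
    {U | ∃ q : MvPolynomial σ k, U = {a | MvPolynomial.eval a q ≠ 0}} U := hU
  induction hU' with
  | basic s hs => obtain ⟨q, rfl⟩ := hs; exact ⟨q, ha, fun b hb => hb⟩
  | univ => exact ⟨1, by simp, fun _ _ => trivial⟩
  | inter s t hs ht ihs iht =>
    obtain ⟨p, hp, hps⟩ := ihs hs ha.1
    obtain ⟨q, hq, hqt⟩ := iht ht ha.2
    refine ⟨p * q, by rw [map_mul]; exact mul_ne_zero hp hq, fun b hb => ?_⟩
    rw [map_mul] at hb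
    exact ⟨hps b (left_ne_zero_of_mul hb), hqt b (right_ne_zero_of_mul hb)⟩
  | sUnion S hS ih =>
    obtain ⟨s, hs, has⟩ := ha
    obtain ⟨q, hq, hqs⟩ := ih s hs (hS s hs) has
    exact ⟨q, hq, fun b hb => ⟨s, hs, hqs b hb⟩⟩

theorem IsZariskiOpen.inter {σ k : Type*} [Field k] {U V : Set (σ → k)}
    (hU : IsZariskiOpen U) (hV : IsZariskiOpen V) : IsZariskiOpen (U ∩ V) :=
  @IsOpen.inter _ (zariskiTopology σ k) _ _ hU hV

/-- Affine space over an infinite field is irreducible. -/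
theorem IsZariskiOpen.inter_nonempty {σ k : Type*} [Field k] [Infinite k] {U V : Set (σ → k)}
    (hU : IsZariskiOpen U) (hV : IsZariskiOpen V) (hU' : U.Nonempty) (hV' : V.Nonempty) :
    (U ∩ V).Nonempty := by
  obtain ⟨a, ha⟩ := hU'
  obtain ⟨b, hb⟩ := hV'
  obtain ⟨p, hp, hpU⟩ := hU.exists_eval_ne_zero ha
  obtain ⟨q, hq, hqV⟩ := hV.exists_eval_ne_zero hb
  have hp0 : p ≠ 0 := by rintro rfl; simp at hp
  have hq0 : q ≠ 0 := by rintro rfl; simp at hq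
  have hpq := mul_ne_zero hp0 hq0
  rw [Ne, MvPolynomial.funext_iff, not_forall] at hpq
  obtain ⟨c, hc⟩ := hpq
  rw [map_mul, map_zero] at hc
  exact ⟨c, hpU c (left_ne_zero_of_mul hc), hqV c (right_ne_zero_of_mul hc)⟩

/-- Affine space is Noetherian: its topology is induced from the prime spectrum of the polynomial
ring along `a ↦ ker (eval a)`. -/
theorem noetherianSpace_zariskiTopology (σ k : Type*) [Finite σ] [Field k] :
    @TopologicalSpace.NoetherianSpace (σ → k) (zariskiTopology σ k) := by
  let φ : (σ → k) → PrimeSpectrum (MvPolynomial σ k) :=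
    fun a => ⟨RingHom.ker (MvPolynomial.eval a), RingHom.ker_isPrime _⟩
  have h : zariskiTopology σ k =
      TopologicalSpace.induced φ PrimeSpectrum.zariskiTopology := by
    rw [PrimeSpectrum.isTopologicalBasis_basic_opens.eq_generateFrom, induced_generateFrom_eq,
      ← Set.range_comp]
    refine congrArg TopologicalSpace.generateFrom ?_
    ext U
    exact exists_congr fun q => eq_comm
  let _ := zariskiTopology σ k
  exact Topology.IsInducing.noetherianSpace (i := φ) ⟨h⟩

theorem IsZariskiOpen.isZariskiConstructible {σ k : Type*} [Finite σ] [Field k]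
    {U : Set (σ → k)} (hU : IsZariskiOpen U) : IsZariskiConstructible U := by
  let _ := zariskiTopology σ k
  have := noetherianSpace_zariskiTopology σ k
  exact IsRetrocompact.isConstructible hU fun _ _ _ => TopologicalSpace.NoetherianSpace.isCompact _

/-- Linear independence of finitely many power series depending polynomially on parameters is an
open condition. If the family is independent at `a₀`, the functionals sending a vector of weights
to the coefficients of the weighted sum span the dual of `k^ι`. So finitely many of them combine,
with constant weights, to a square matrix over the parameter ring that is the identity at `a₀`;
its determinant is the function sought. -/
theorem isZariskiOpen_linearIndependent {σ ι k : Type*} [Finite ι] [Field k]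
    (G : ι → (MvPolynomial σ k)⟦X⟧) :
    IsZariskiOpen {a : σ → k |
      LinearIndependent k fun i => PowerSeries.map (MvPolynomial.eval a) (G i)} := by
  classical
  have := Fintype.ofFinite ι
  refine isZariskiOpen_of_forall_exists fun a₀ h₀ => ?_
  rw [Set.mem_ofPred_eq, Fintype.linearIndependent_iff] at h₀
  let r : ℕ → Module.Dual k (ι → k) := fun n =>
    ∑ i, MvPolynomial.eval a₀ (PowerSeries.coeff n (G i)) • LinearMap.proj i
  have hr : ∀ n v, r n v = ∑ i, MvPolynomial.eval a₀ (PowerSeries.coeff n (G i)) * v i := by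
    intro n v
    simp [r]
  have hbot : (Submodule.span k (Set.range r)).dualCoannihilator = ⊥ := by
    rw [eq_bot_iff]
    intro v hv
    rw [Submodule.mem_dualCoannihilator] at hv
    refine funext (h₀ v ?_)
    ext n
    have h1 := hv (r n) (Submodule.subset_span ⟨n, rfl⟩)
    rw [hr] at h1
    simpa [mul_comm] using h1
  have htop : Submodule.span k (Set.range r) = ⊤ := by
    rw [← Subspace.dualCoannihilator_dualAnnihilator_eq (W := Submodule.span k (Set.range r)),
      hbot, Submodule.dualAnnihilator_bot]
  have hc : ∀ i : ι, ∃ c : ℕ →₀ k, (c.sum fun n b => b • r n) = LinearMap.proj i := fun i =>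
    Finsupp.mem_span_range_iff_exists_finsupp.mp (htop ▸ Submodule.mem_top)
  choose c hc using hc
  let N : Matrix ι ι (MvPolynomial σ k) := Matrix.of fun i j =>
    (c i).sum fun n b => MvPolynomial.C b * PowerSeries.coeff n (G j)
  have hN : ∀ a i j, (MvPolynomial.eval a).mapMatrix N i j =
      (c i).sum fun n b => b * MvPolynomial.eval a (PowerSeries.coeff n (G j)) := by
    intro a i j
    simp [N, Finsupp.sum, Matrix.map_apply]
  refine ⟨N.det, ?_, fun a ha => ?_⟩
  · have h1 : (MvPolynomial.eval a₀).mapMatrix N = 1 := by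
      ext i j
      rw [hN]
      have h2 := congrArg (fun l : Module.Dual k (ι → k) => l (Pi.single j 1)) (hc i)
      simpa [Finsupp.sum, hr, Pi.single_apply, Matrix.one_apply] using h2
    rw [RingHom.map_det, h1, Matrix.det_one]
    exact one_ne_zero
  · rw [Set.mem_ofPred_eq, Fintype.linearIndependent_iff]
    intro v hv
    rw [RingHom.map_det] at ha
    refine congrFun (Matrix.eq_zero_of_mulVec_eq_zero ha ?_)
    ext i
    have hv' : ∀ n, ∑ j, MvPolynomial.eval a (PowerSeries.coeff n (G j)) * v j = 0 := by
      intro n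
      simpa [mul_comm] using congrArg (PowerSeries.coeff n) hv
    simp only [Matrix.mulVec, dotProduct, hN, Finsupp.sum, Finset.sum_mul, Pi.zero_apply]
    rw [Finset.sum_comm]
    refine Finset.sum_eq_zero fun n _ => ?_
    simp only [mul_assoc]
    rw [← Finset.mul_sum, hv', mul_zero]

/-! ### Normalised polynomials and their coefficient vectors -/

theorem mem_coeffIndex {d h : ℕ} {p : ℕ × ℕ} :
    p ∈ coeffIndex d h ↔ (p.1 ≤ h ∧ p.2 ≤ d) ∧ p ≠ (0, 0) ∧ p ≠ (0, 1) := by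
  simp only [coeffIndex, Finset.mem_sdiff, Finset.mem_product, Finset.mem_range,
    Finset.mem_insert, Finset.mem_singleton, Nat.lt_succ_iff, not_or, ne_eq]

theorem card_coeffIndex {d h : ℕ} (hd : 1 ≤ d) :
    (coeffIndex d h).card = d * h + d + h - 1 := by
  have hsub : ({(0, 0), (0, 1)} : Finset (ℕ × ℕ)) ⊆
      Finset.range (h + 1) ×ˢ Finset.range (d + 1) := by
    intro p hp
    simp only [Finset.mem_insert, Finset.mem_singleton] at hp
    rcases hp with rfl | rfl <;> simp; omega
  rw [coeffIndex, Finset.card_sdiff_of_subset hsub, Finset.card_product, Finset.card_range,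
    Finset.card_range, Finset.card_pair (by simp)]
  have : (h + 1) * (d + 1) = d * h + d + h + 1 := by ring
  omega

theorem coeff_coeff_polyOf {d h : ℕ} {R : Type*} [CommRing R] (a : CoeffSpace d h R) (i j : ℕ) :
    ((polyOf a).coeff j).coeff i =
      if hp : (i, j) ∈ coeffIndex d h then a ⟨(i, j), hp⟩ else if (i, j) = (0, 1) then 1 else 0 := by
  have hterm : ∀ p : coeffIndex d h, ((Polynomial.C (Polynomial.C (a p) * Polynomial.X ^ p.1.1) *
      Polynomial.X ^ p.1.2 : R[X][X]).coeff j).coeff i = if (i, j) = p.1 then a p else 0 := by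
    rintro ⟨⟨m, n⟩, hp⟩
    rw [Polynomial.coeff_C_mul_X_pow]
    by_cases hj : j = n <;> simp [hj]
  have hX : ((Polynomial.X : R[X][X]).coeff j).coeff i = if (i, j) = (0, 1) then 1 else 0 := by
    rw [Polynomial.coeff_X]
    by_cases hj : j = 1 <;> simp [hj, eq_comm, Polynomial.coeff_one]
  rw [polyOf, Polynomial.coeff_add, Polynomial.coeff_add, Polynomial.finsetSum_coeff,
    Polynomial.finsetSum_coeff, hX, Finset.sum_congr rfl fun p _ => hterm p]
  by_cases h1 : (i, j) ∈ coeffIndex d h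
  · rw [dif_pos h1, if_neg (mem_coeffIndex.mp h1).2.2, zero_add,
      Finset.sum_eq_single ⟨(i, j), h1⟩, if_pos rfl]
    · rintro p - hp
      exact if_neg fun H => hp (Subtype.ext H.symm)
    · exact fun H => absurd (Finset.mem_univ _) H
  · rw [dif_neg h1, Finset.sum_eq_zero, add_zero]
    rintro p -
    exact if_neg fun H : (i, j) = p.1 => h1 (H ▸ p.2)

theorem polyOf_injective {d h : ℕ} {R : Type*} [CommRing R] :
    Function.Injective (fun a : CoeffSpace d h R => polyOf a) := by
  intro a b hab
  funext p
  have h1 := congrArg (fun P : R[X][X] => (P.coeff p.1.2).coeff p.1.1) hab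
  simpa only [coeff_coeff_polyOf, Prod.mk.eta, p.2, dif_pos] using h1

theorem coeff_one_coeff_zero_polyOf {d h : ℕ} {R : Type*} [CommRing R] (a : CoeffSpace d h R) :
    ((polyOf a).coeff 1).coeff 0 = 1 := by
  rw [coeff_coeff_polyOf, dif_neg (fun H => (mem_coeffIndex.mp H).2.2 rfl), if_pos rfl]

theorem coeff_zero_coeff_zero_polyOf {d h : ℕ} {R : Type*} [CommRing R] (a : CoeffSpace d h R) :
    ((polyOf a).coeff 0).coeff 0 = 0 := by
  rw [coeff_coeff_polyOf, dif_neg (fun H => (mem_coeffIndex.mp H).2.1 rfl), if_neg (by simp)]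

theorem polyOf_ne_zero {d h : ℕ} {R : Type*} [CommRing R] [Nontrivial R] (a : CoeffSpace d h R) :
    polyOf a ≠ 0 := fun H => by
  simpa [H] using coeff_one_coeff_zero_polyOf a

theorem natDegree_le_iff_coeff_coeff {k : Type*} [Field k] {P : k[X][X]} {d : ℕ} :
    P.natDegree ≤ d ↔ ∀ i j, d < j → (P.coeff j).coeff i = 0 := by
  rw [natDegree_le_iff_coeff_eq_zero]
  simp only [Polynomial.ext_iff, Polynomial.coeff_zero]
  exact ⟨fun H i j hj => H j hj i, fun H j hj i => H i j hj⟩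

theorem natDegree_polyOf_le {k : Type*} [Field k] {d h : ℕ} (hd : 1 ≤ d) (a : CoeffSpace d h k) :
    (polyOf a).natDegree ≤ d := by
  refine natDegree_le_iff_coeff_coeff.mpr fun i j hj => ?_
  rw [coeff_coeff_polyOf, dif_neg, if_neg]
  · rintro ⟨⟩; omega
  · exact fun H => absurd (mem_coeffIndex.mp H).1.2 (not_le.mpr hj)

theorem polyHeight_polyOf_le {k : Type*} [Field k] {d h : ℕ} (a : CoeffSpace d h k) :
    polyHeight (polyOf a) ≤ h := by
  refine polyHeight_le_iff.mpr fun i j hi => ?_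
  rw [coeff_coeff_polyOf, dif_neg, if_neg]
  · rintro ⟨⟩; omega
  · exact fun H => absurd (mem_coeffIndex.mp H).1.1 (not_le.mpr hi)

/-- A normalised polynomial of bounded bidegree is recovered from its coefficient vector. -/
theorem polyOf_coeff {k : Type*} [Field k] {d h : ℕ} {P : k[X][X]}
    (h0 : (P.coeff 0).coeff 0 = 0) (h1 : (P.coeff 1).coeff 0 = 1) (hh : polyHeight P ≤ h)
    (hd : P.natDegree ≤ d) :
    polyOf (fun p : coeffIndex d h => (P.coeff p.1.2).coeff p.1.1) = P := by
  ext j i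
  rw [coeff_coeff_polyOf]
  split_ifs with hp h2
  · rfl
  · cases h2; exact h1.symm
  · rw [mem_coeffIndex] at hp
    by_cases h3 : (i, j) = (0, 0)
    · cases h3; exact h0.symm
    · rw [eq_comm]
      by_cases hi : i ≤ h
      · by_cases hj : j ≤ d
        · exact absurd ⟨⟨hi, hj⟩, h3, h2⟩ hp
        · exact natDegree_le_iff_coeff_coeff.mp hd i j (not_le.mp hj)
      · exact polyHeight_le_iff.mp hh i j (not_le.mp hi)

theorem bijOn_polyOf {k : Type*} [Field k] {d h : ℕ} (hd : 1 ≤ d) :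
    Set.BijOn (fun a : CoeffSpace d h k => polyOf a) Set.univ
      {P : k[X][X] | P.evalEval 0 0 = 0 ∧ (derivative P).evalEval 0 0 = 1 ∧
        polyHeight P ≤ h ∧ P.natDegree ≤ d} := by
  refine ⟨fun a _ => ⟨?_, ?_, polyHeight_polyOf_le a, natDegree_polyOf_le hd a⟩,
    polyOf_injective.injOn, fun P hP => ⟨_, Set.mem_univ _, polyOf_coeff ?_ ?_ hP.2.2.1 hP.2.2.2⟩⟩
  · rw [evalEval_zero_zero, coeff_zero_coeff_zero_polyOf]
  · rw [derivative_evalEval_zero_zero, coeff_one_coeff_zero_polyOf]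
  · rw [← evalEval_zero_zero, hP.1]
  · rw [← derivative_evalEval_zero_zero, hP.2.1]

theorem polyOf_coeffExt {k : Type*} [Field k] {d h d' h' : ℕ} (hd : d ≤ d') (hh : h ≤ h')
    (a : CoeffSpace d h k) : polyOf (coeffExt d' h' a) = polyOf a := by
  ext j i
  rw [coeff_coeff_polyOf, coeff_coeff_polyOf]
  by_cases h1 : (i, j) ∈ coeffIndex d h
  · have h2 : (i, j) ∈ coeffIndex d' h' := by
      rw [mem_coeffIndex] at h1 ⊢
      exact ⟨⟨h1.1.1.trans hh, h1.1.2.trans hd⟩, h1.2⟩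
    rw [dif_pos h1, dif_pos h2, coeffExt, dif_pos h1]
  · rw [dif_neg h1]
    by_cases h2 : (i, j) ∈ coeffIndex d' h'
    · rw [dif_pos h2, coeffExt, dif_neg h1, if_neg (mem_coeffIndex.mp h2).2.2]
    · rw [dif_neg h2]

theorem coeffProj_coeffExt {k : Type*} [Field k] {d h d' h' : ℕ} (hd : d ≤ d') (hh : h ≤ h')
    (a : CoeffSpace d h k) : coeffProj hd hh (coeffExt d' h' a) = a :=
  funext fun p => dif_pos p.2

/-! ### The root of a normalised polynomial and the minimal polynomial of a series -/

theorem univRoot_spec (k : Type*) [Field k] (d h : ℕ) :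
    PowerSeries.constantCoeff (univRoot k d h) = 0 ∧
      aeval (univRoot k d h) (polyOf fun p : coeffIndex d h =>
        (MvPolynomial.X p : MvPolynomial (coeffIndex d h) k)) = 0 :=
  Classical.choose_spec (existsUnique_root_polyOf
    (fun p : coeffIndex d h => (MvPolynomial.X p : MvPolynomial (coeffIndex d h) k))).exists

theorem aeval_polyOf {d h : ℕ} {R : Type*} [CommRing R] (a : CoeffSpace d h R) (F : R⟦X⟧) :
    aeval F (polyOf a) =
      F + ∑ p : coeffIndex d h, PowerSeries.C (a p) * PowerSeries.X ^ p.1.1 * F ^ p.1.2 := by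
  have hX : algebraMap R[X] R⟦X⟧ Polynomial.X = PowerSeries.X := Polynomial.coe_X
  have hC : ∀ c, algebraMap R[X] R⟦X⟧ (Polynomial.C c) = PowerSeries.C c := Polynomial.coe_C
  simp only [polyOf, map_add, aeval_X, map_sum, map_mul, aeval_C, map_pow, hX, hC]

theorem constantCoeff_rootMap {k : Type*} [Field k] {d h : ℕ} (a : CoeffSpace d h k) :
    PowerSeries.constantCoeff (rootMap a) = 0 := by
  rw [← PowerSeries.coeff_zero_eq_constantCoeff_apply, rootMap, PowerSeries.coeff_map,
    PowerSeries.coeff_zero_eq_constantCoeff_apply, (univRoot_spec k d h).1, map_zero]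

theorem aeval_rootMap_polyOf {k : Type*} [Field k] {d h : ℕ} (a : CoeffSpace d h k) :
    aeval (rootMap a) (polyOf a) = 0 := by
  have h1 := congrArg (PowerSeries.map (MvPolynomial.eval a)) (univRoot_spec k d h).2
  rw [aeval_polyOf] at h1
  rw [aeval_polyOf, rootMap]
  simpa only [map_add, map_sum, map_mul, map_pow, PowerSeries.map_C, PowerSeries.map_X,
    MvPolynomial.eval_X, map_zero] using h1

theorem eq_rootMap {k : Type*} [Field k] {d h : ℕ} {a : CoeffSpace d h k} {f : k⟦X⟧}
    (h0 : PowerSeries.constantCoeff f = 0) (hf : aeval f (polyOf a) = 0) : f = rootMap a :=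
  (existsUnique_root_polyOf a).unique ⟨h0, hf⟩ ⟨constantCoeff_rootMap a, aeval_rootMap_polyOf a⟩

/-- The minimal polynomial of the root of `P_a` divides `P_a`, hence obeys the same degree bounds,
and it inherits the nonvanishing of `∂P/∂T` at the origin, since it has no constant term. -/
theorem rootMap_mem_iftSeries {k : Type*} [Field k] {d h : ℕ} (hd : 1 ≤ d)
    (a : CoeffSpace d h k) : rootMap a ∈ iftSeries k d h := by
  have hP := polyOf_ne_zero a
  obtain ⟨Q, hQ, hdvd, hroot⟩ := exists_irreducible_dvd_aeval_eq_zero hP (aeval_rootMap_polyOf a)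
  have hmin := hQ.isMinimalPolynomial hroot
  have hQ0 := coeff_zero_coeff_zero_eq_zero (constantCoeff_rootMap a) hroot
  refine ⟨⟨⟨⟨polyOf a, hP, aeval_rootMap_polyOf a⟩, Q, hmin,
    (natDegree_le_of_dvd hdvd hP).trans (natDegree_polyOf_le hd a),
    (polyHeight_le_of_dvd hdvd hP).trans (polyHeight_polyOf_le a)⟩, constantCoeff_rootMap a⟩,
    Q, hmin, ?_, ?_⟩
  · rw [evalEval_zero_zero, hQ0]
  · rw [derivative_evalEval_zero_zero]
    intro hQ1
    obtain ⟨R, hR⟩ := hdvd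
    have h1 := coeff_one_coeff_zero_polyOf a
    rw [hR, Polynomial.coeff_mul] at h1
    simp [Finset.Nat.antidiagonal_succ, Polynomial.mul_coeff_zero, hQ0, hQ1]
      at h1

theorem isMinimalPolynomial_polyOf_psi {k : Type*} [Field k] {d h : ℕ} (f : iftSeries k d h) :
    IsMinimalPolynomial (f : k⟦X⟧) (polyOf (psi f)) := by
  obtain ⟨hmin, h0, h1⟩ := Classical.choose_spec f.2.2
  obtain ⟨Q, hQ, hQd, hQh⟩ := f.2.1.1.2
  set P := Classical.choose f.2.2
  rw [evalEval_zero_zero] at h0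
  rw [derivative_evalEval_zero_zero] at h1
  have hP0 : P ≠ 0 := fun H => h1 (by simp [H])
  have hdvd := (hmin.associated hQ).dvd
  have hQ0 : Q ≠ 0 := fun H => hP0 ((hmin.associated hQ).eq_zero_iff.mpr H)
  set u : k := ((P.coeff 1).coeff 0)⁻¹
  have hu0 : u ≠ 0 := inv_ne_zero h1
  have hunit : IsUnit (Polynomial.C (Polynomial.C u) : k[X][X]) :=
    ((isUnit_iff_ne_zero.mpr hu0).map Polynomial.C).map Polynomial.C
  have hass : Associated P (Polynomial.C (Polynomial.C u) * P) :=
    (associated_unit_mul_left P _ hunit).symm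
  have hcoeff : ∀ i j, ((Polynomial.C (Polynomial.C u) * P).coeff j).coeff i =
      u * (P.coeff j).coeff i := fun i j => by rw [Polynomial.coeff_C_mul, Polynomial.coeff_C_mul]
  -- `P` has its degree bounds only through its associate `Q`
  have hdvdQ : Polynomial.C (Polynomial.C u) * P ∣ Q := hass.symm.dvd.trans hdvd
  have key : polyOf (psi f) = Polynomial.C (Polynomial.C u) * P := by
    rw [← polyOf_coeff (d := d) (h := h) (P := Polynomial.C (Polynomial.C u) * P)
      (by rw [hcoeff, h0, mul_zero]) (by rw [hcoeff, inv_mul_cancel₀ h1])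
      ((polyHeight_le_of_dvd hdvdQ hQ0).trans hQh) ((natDegree_le_of_dvd hdvdQ hQ0).trans hQd)]
    refine congrArg polyOf (funext fun p => ?_)
    rw [hcoeff, psi, div_eq_inv_mul]
  rw [key]
  exact hmin.congr hass

theorem constantCoeff_iftSeries {k : Type*} [Field k] {d h : ℕ} (f : iftSeries k d h) :
    PowerSeries.constantCoeff (f : k⟦X⟧) = 0 := f.2.1.2

theorem rootMap_psi {k : Type*} [Field k] {d h : ℕ} (f : iftSeries k d h) :
    rootMap (psi f) = (f : k⟦X⟧) :=
  (eq_rootMap (constantCoeff_iftSeries f)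
    (isMinimalPolynomial_polyOf_psi f).aeval_eq_zero).symm

theorem psi_injective {k : Type*} [Field k] {d h : ℕ} :
    Function.Injective (psi : iftSeries k d h → CoeffSpace d h k) := fun f g hfg =>
  Subtype.ext (by rw [← rootMap_psi f, ← rootMap_psi g, hfg])

theorem irreducible_polyOf_psi {k : Type*} [Field k] {d h : ℕ} (f : iftSeries k d h) :
    Irreducible (polyOf (psi f)) :=
  (isMinimalPolynomial_polyOf_psi f).irreducible (polyOf_ne_zero _)

/-- Normalised minimal polynomials are unique. -/
theorem polyOf_psi_eq {k : Type*} [Field k] {d h d' h' : ℕ} {f : iftSeries k d h}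
    {a : CoeffSpace d' h' k} (ha : IsMinimalPolynomial (f : k⟦X⟧) (polyOf a)) :
    polyOf (psi f) = polyOf a :=
  eq_of_associated_of_coeff_eq ((isMinimalPolynomial_polyOf_psi f).associated ha)
    (by rw [coeff_one_coeff_zero_polyOf, coeff_one_coeff_zero_polyOf])
    (by rw [coeff_one_coeff_zero_polyOf]; exact one_ne_zero)

theorem psi_eq_iff_irreducible {k : Type*} [Field k] {d h : ℕ} {f : iftSeries k d h}
    {a : CoeffSpace d h k} (hf : (f : k⟦X⟧) = rootMap a) :
    psi f = a ↔ Irreducible (polyOf a) := by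
  refine ⟨fun H => H ▸ irreducible_polyOf_psi f, fun H => polyOf_injective (polyOf_psi_eq ?_)⟩
  exact H.isMinimalPolynomial (by rw [hf, aeval_rootMap_polyOf])

theorem range_psi {k : Type*} [Field k] {d h : ℕ} (hd : 1 ≤ d) :
    Set.range (psi : iftSeries k d h → CoeffSpace d h k) = {a | Irreducible (polyOf a)} := by
  ext a
  constructor
  · rintro ⟨f, rfl⟩
    exact irreducible_polyOf_psi f
  · exact fun ha => ⟨⟨rootMap a, rootMap_mem_iftSeries hd a⟩, (psi_eq_iff_irreducible rfl).mpr ha⟩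

theorem iftSeries_subset {k : Type*} [Field k] {d h d' h' : ℕ} (hd : d ≤ d') (hh : h ≤ h') :
    iftSeries k d h ⊆ iftSeries k d' h' :=
  fun _ ⟨⟨⟨halg, P, hP, hPd, hPh⟩, h0⟩, hift⟩ =>
    ⟨⟨⟨halg, P, hP, hPd.trans hd, hPh.trans hh⟩, h0⟩, hift⟩

theorem rootMap_coeffExt {k : Type*} [Field k] {d h d' h' : ℕ} (hd : d ≤ d') (hh : h ≤ h')
    (a : CoeffSpace d h k) : rootMap (coeffExt d' h' a) = rootMap a :=
  eq_rootMap (constantCoeff_rootMap _)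
    (by rw [← polyOf_coeffExt hd hh a, aeval_rootMap_polyOf])

theorem psi_inclusion {k : Type*} [Field k] {d h d' h' : ℕ} (hd : d ≤ d') (hh : h ≤ h')
    (hI : iftSeries k d h ⊆ iftSeries k d' h') (f : iftSeries k d h) :
    psi (Set.inclusion hI f) = coeffExt d' h' (psi f) := by
  refine polyOf_injective (polyOf_psi_eq ?_)
  rw [polyOf_coeffExt hd hh]
  exact isMinimalPolynomial_polyOf_psi f

/-! ### Irreducibility as absence of smaller linear relations -/

/-- The power series `x^i f^j` with `i < q` and `j < p`. Linear relations between them are the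
polynomials of degree less than `p` and height less than `q` that annihilate `f`. -/
noncomputable def monomialValues {R : Type*} [CommRing R] (f : R⟦X⟧) (p q : ℕ)
    (e : Fin q × Fin p) : R⟦X⟧ :=
  PowerSeries.X ^ (e.1 : ℕ) * f ^ (e.2 : ℕ)

theorem map_monomialValues {R S : Type*} [CommRing R] [CommRing S] (φ : R →+* S) (f : R⟦X⟧)
    (p q : ℕ) (e : Fin q × Fin p) :
    PowerSeries.map φ (monomialValues f p q e) = monomialValues (PowerSeries.map φ f) p q e := by
  simp [monomialValues]

/-- The polynomial `∑ v_{i,j} x^i T^j`. -/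
noncomputable def polyOfCoeffs {k : Type*} [Field k] {p q : ℕ} (v : Fin q × Fin p → k) : k[X][X] :=
  ∑ e, Polynomial.C (Polynomial.C (v e) * Polynomial.X ^ (e.1 : ℕ)) * Polynomial.X ^ (e.2 : ℕ)

theorem coeff_coeff_polyOfCoeffs {k : Type*} [Field k] {p q : ℕ} (v : Fin q × Fin p → k)
    (i j : ℕ) : ((polyOfCoeffs v).coeff j).coeff i =
      if h : i < q ∧ j < p then v (⟨i, h.1⟩, ⟨j, h.2⟩) else 0 := by
  have hterm : ∀ e : Fin q × Fin p, ((Polynomial.C (Polynomial.C (v e) *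
      Polynomial.X ^ (e.1 : ℕ)) * Polynomial.X ^ (e.2 : ℕ) : k[X][X]).coeff j).coeff i =
      if i = e.1 ∧ j = e.2 then v e else 0 := by
    intro e
    rw [Polynomial.coeff_C_mul_X_pow]
    by_cases hj : j = e.2 <;> simp [hj]
  rw [polyOfCoeffs, Polynomial.finsetSum_coeff, Polynomial.finsetSum_coeff,
    Finset.sum_congr rfl fun e _ => hterm e]
  split_ifs with h
  · rw [Finset.sum_eq_single (⟨i, h.1⟩, ⟨j, h.2⟩), if_pos ⟨rfl, rfl⟩]
    · rintro e - he
      exact if_neg fun H => he (Prod.ext (Fin.ext H.1.symm) (Fin.ext H.2.symm))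
    · exact fun H => absurd (Finset.mem_univ _) H
  · refine Finset.sum_eq_zero fun e _ => if_neg fun H => h ?_
    exact ⟨H.1 ▸ e.1.2, H.2 ▸ e.2.2⟩

theorem aeval_polyOfCoeffs {k : Type*} [Field k] {p q : ℕ} (v : Fin q × Fin p → k) (f : k⟦X⟧) :
    aeval f (polyOfCoeffs v) = ∑ e, v e • monomialValues f p q e := by
  have hX : algebraMap k[X] k⟦X⟧ Polynomial.X = PowerSeries.X := Polynomial.coe_X
  have hC : ∀ c, algebraMap k[X] k⟦X⟧ (Polynomial.C c) = PowerSeries.C c := Polynomial.coe_C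
  simp only [polyOfCoeffs, monomialValues, map_sum, map_mul, aeval_C, aeval_X, map_pow, hX, hC,
    PowerSeries.smul_eq_C_mul, mul_assoc]

theorem linearIndependent_monomialValues_iff {k : Type*} [Field k] {f : k⟦X⟧} {p q : ℕ} :
    LinearIndependent k (monomialValues f p q) ↔
      ∀ Q : k[X][X], Q ≠ 0 → aeval f Q = 0 → ¬ (Q.natDegree < p ∧ polyHeight Q < q) := by
  rw [Fintype.linearIndependent_iff]
  constructor
  · rintro H Q hQ hfQ ⟨hp, hq⟩
    have hQv : polyOfCoeffs (fun e : Fin q × Fin p => (Q.coeff e.2).coeff e.1) = Q := by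
      ext j i
      rw [coeff_coeff_polyOfCoeffs]
      split_ifs with h
      · rfl
      · rw [eq_comm]
        rcases not_and_or.mp h with h | h
        · exact polyHeight_le_iff.mp le_rfl i j (hq.trans_le (not_lt.mp h))
        · exact natDegree_le_iff_coeff_coeff.mp le_rfl i j (hp.trans_le (not_lt.mp h))
    rw [← hQv, aeval_polyOfCoeffs] at hfQ
    have h0 := funext (H _ hfQ)
    refine hQ ?_
    rw [← hQv, h0]
    simp [polyOfCoeffs]
  · intro H v hv
    by_contra hne
    obtain ⟨⟨i, j⟩, he⟩ := not_forall.mp hne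
    have hi := i.2
    have hj := j.2
    refine H (polyOfCoeffs v) ?_ (by rw [aeval_polyOfCoeffs, hv]) ⟨?_, ?_⟩
    · intro h0
      have h1 := coeff_coeff_polyOfCoeffs v i j
      rw [h0, dif_pos ⟨hi, hj⟩] at h1
      exact he (by simpa using h1.symm)
    · refine Nat.lt_of_le_pred (by omega) (natDegree_le_iff_coeff_coeff.mpr fun m n hn => ?_)
      rw [coeff_coeff_polyOfCoeffs, dif_neg]
      rw [Nat.pred_eq_sub_one] at hn
      omega
    · refine Nat.lt_of_le_pred (by omega) (polyHeight_le_iff.mpr fun m n hm => ?_)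
      rw [coeff_coeff_polyOfCoeffs, dif_neg]
      rw [Nat.pred_eq_sub_one] at hm
      omega

/-- The parameters `a` for which no nonzero polynomial of degree less than `p` and height less
than `q` annihilates the root of `P_a`. -/
def noRelationLocus (k : Type*) [Field k] (d h p q : ℕ) : Set (CoeffSpace d h k) :=
  {a | LinearIndependent k (monomialValues (rootMap a) p q)}

theorem isZariskiOpen_noRelationLocus (k : Type*) [Field k] (d h p q : ℕ) :
    IsZariskiOpen (noRelationLocus k d h p q) := by
  have h1 := isZariskiOpen_linearIndependent (monomialValues (univRoot k d h) p q)
  simp only [map_monomialValues] at h1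
  exact h1

/-- If no annihilating polynomial has smaller degree or smaller height than `P_a`, then the
minimal polynomial of the root has the bidegree of its multiple `P_a`, so the cofactor is
constant. -/
theorem irreducible_polyOf_of_mem_noRelationLocus {k : Type*} [Field k] {d h p q : ℕ}
    {a : CoeffSpace d h k} (hp : (polyOf a).natDegree ≤ p) (hq : polyHeight (polyOf a) ≤ q)
    (h1 : a ∈ noRelationLocus k d h p (q + 1)) (h2 : a ∈ noRelationLocus k d h (p + 1) q) :
    Irreducible (polyOf a) := by
  have h1' := linearIndependent_monomialValues_iff.mp h1
  have h2' := linearIndependent_monomialValues_iff.mp h2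
  have hP := polyOf_ne_zero a
  obtain ⟨Q, hQ, ⟨R, hR⟩, hroot⟩ :=
    exists_irreducible_dvd_aeval_eq_zero hP (aeval_rootMap_polyOf a)
  have hR0 : R ≠ 0 := by rintro rfl; exact hP (by rw [hR, mul_zero])
  rw [hR, natDegree_mul hQ.ne_zero hR0] at hp
  rw [hR, polyHeight_mul hQ.ne_zero hR0] at hq
  have h3 := h1' Q hQ.ne_zero hroot
  have h4 := h2' Q hQ.ne_zero hroot
  have hunit : IsUnit R :=
    isUnit_of_natDegree_eq_zero_of_polyHeight_eq_zero hR0 (by omega) (by omega)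
  rw [hR]
  exact (associated_mul_unit_right Q R hunit).irreducible hQ

theorem mem_noRelationLocus_of_irreducible {k : Type*} [Field k] {d h : ℕ} (p q : ℕ)
    {a : CoeffSpace d h k} (ha : Irreducible (polyOf a))
    (hpq : p ≤ (polyOf a).natDegree ∨ q ≤ polyHeight (polyOf a)) :
    a ∈ noRelationLocus k d h p q := by
  refine linearIndependent_monomialValues_iff.mpr fun Q hQ hroot => ?_
  have hdvd := (ha.isMinimalPolynomial (aeval_rootMap_polyOf a)).dvd hroot
  have h1 := natDegree_le_of_dvd hdvd hQ
  have h2 := polyHeight_le_of_dvd hdvd hQ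
  omega

/-! ### The irreducible locus -/

/-- The parameters `a` such that `P_a` has degree at most `p` and height at most `q`. -/
def degreeLocus (k : Type*) [Field k] (d h p q : ℕ) : Set (CoeffSpace d h k) :=
  {a | (polyOf a).natDegree ≤ p ∧ polyHeight (polyOf a) ≤ q}

theorem isZariskiOpen_compl_degreeLocus (k : Type*) [Field k] (d h p q : ℕ) :
    IsZariskiOpen (degreeLocus k d h p q)ᶜ := by
  refine isZariskiOpen_of_forall_exists fun a ha => ?_
  have hex : ∃ i j, (p < j ∨ q < i) ∧ ((polyOf a).coeff j).coeff i ≠ 0 := by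
    by_contra! H
    exact ha ⟨natDegree_le_iff_coeff_coeff.mpr fun i j hj => H i j (Or.inl hj),
      polyHeight_le_iff.mpr fun i j hi => H i j (Or.inr hi)⟩
  obtain ⟨i, j, hij, hne⟩ := hex
  have heval : ∀ b : CoeffSpace d h k, MvPolynomial.eval b
      (((polyOf fun p : coeffIndex d h =>
        (MvPolynomial.X p : MvPolynomial (coeffIndex d h) k)).coeff j).coeff i) =
      ((polyOf b).coeff j).coeff i := by
    intro b
    rw [coeff_coeff_polyOf, coeff_coeff_polyOf]
    split_ifs <;> simp
  refine ⟨_, by rw [heval]; exact hne, fun b hb hbW => ?_⟩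
  rw [heval] at hb
  rcases hij with hj | hi
  · exact hb (natDegree_le_iff_coeff_coeff.mp hbW.1 i j hj)
  · exact hb (polyHeight_le_iff.mp hbW.2 i j hi)

/-- The irreducible locus, stratified by bounds for the bidegree: on the stratum of bidegree at
most `(p, q)` irreducibility with exactly that bidegree is the absence of smaller relations. -/
theorem setOf_irreducible_polyOf_eq {k : Type*} [Field k] {d h : ℕ} (hd : 1 ≤ d) :
    {a : CoeffSpace d h k | Irreducible (polyOf a)} =
      ⋃ e : Fin (d + 1) × Fin (h + 1), degreeLocus k d h e.1 e.2 ∩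
        (noRelationLocus k d h e.1 (e.2 + 1) ∩ noRelationLocus k d h (e.1 + 1) e.2) := by
  ext a
  rw [Set.mem_iUnion]
  constructor
  · intro ha
    refine ⟨(⟨(polyOf a).natDegree, Nat.lt_succ_of_le (natDegree_polyOf_le hd a)⟩,
      ⟨polyHeight (polyOf a), Nat.lt_succ_of_le (polyHeight_polyOf_le a)⟩), ⟨le_rfl, le_rfl⟩,
      ?_, ?_⟩
    · exact mem_noRelationLocus_of_irreducible _ _ ha (Or.inl le_rfl)
    · exact mem_noRelationLocus_of_irreducible _ _ ha (Or.inr le_rfl)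
  · rintro ⟨e, ⟨h1, h2⟩, h3, h4⟩
    exact irreducible_polyOf_of_mem_noRelationLocus h1 h2 h3 h4

theorem isZariskiConstructible_setOf_irreducible {k : Type*} [Field k] {d h : ℕ} (hd : 1 ≤ d) :
    IsZariskiConstructible {a : CoeffSpace d h k | Irreducible (polyOf a)} := by
  rw [setOf_irreducible_polyOf_eq hd]
  let _ := zariskiTopology (coeffIndex d h) k
  refine IsConstructible.iUnion fun e => IsConstructible.inter ?_ (IsConstructible.inter ?_ ?_)
  · exact isConstructible_compl.mp
      (isZariskiOpen_compl_degreeLocus k d h e.1 e.2).isZariskiConstructible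
  · exact (isZariskiOpen_noRelationLocus k d h e.1 (e.2 + 1)).isZariskiConstructible
  · exact (isZariskiOpen_noRelationLocus k d h (e.1 + 1) e.2).isZariskiConstructible

/-- Some irreducible `P_a` has the largest possible bidegree. -/
theorem exists_irreducible_polyOf {k : Type*} [Field k] {d h : ℕ} (hd : 1 ≤ d) (hh : 1 ≤ h) :
    ∃ a : CoeffSpace d h k, Irreducible (polyOf a) ∧ d ≤ (polyOf a).natDegree ∧
      h ≤ polyHeight (polyOf a) := by
  set P : k[X][X] := Polynomial.X +
    Polynomial.C (Polynomial.X ^ h) * (1 + Polynomial.X ^ d) with hPdef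
  have hcoeff : ∀ i j, (P.coeff j).coeff i = (if i = 0 ∧ j = 1 then 1 else 0) +
      if i = h then (if j = 0 then 1 else 0) + (if j = d then 1 else 0) else 0 := by
    intro i j
    have h1 : (1 + Polynomial.X ^ d : k[X][X]).coeff j =
        Polynomial.C ((if j = 0 then 1 else 0) + (if j = d then 1 else 0)) := by
      rw [Polynomial.coeff_add, Polynomial.coeff_one, Polynomial.coeff_X_pow, Polynomial.C_add]
      split_ifs <;> simp
    have h2 : ((Polynomial.X : k[X][X]).coeff j).coeff i = if i = 0 ∧ j = 1 then 1 else 0 := by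
      rw [Polynomial.coeff_X]
      by_cases hj : j = 1 <;> simp [hj, eq_comm, Polynomial.coeff_one]
    rw [hPdef, Polynomial.coeff_add, Polynomial.coeff_C_mul, Polynomial.coeff_add, h1, h2,
      mul_comm, Polynomial.coeff_C_mul, Polynomial.coeff_X_pow, mul_ite, mul_one, mul_zero]
  have hP : polyOf (fun p : coeffIndex d h => (P.coeff p.1.2).coeff p.1.1) = P := by
    refine polyOf_coeff ?_ ?_ (polyHeight_le_iff.mpr fun i j hi => ?_)
      (natDegree_le_iff_coeff_coeff.mpr fun i j hj => ?_)
    · rw [hcoeff, if_neg (by omega), if_neg (by omega), add_zero]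
    · rw [hcoeff, if_pos ⟨rfl, rfl⟩, if_neg (by omega), add_zero]
    · rw [hcoeff, if_neg (by omega), if_neg (by omega), add_zero]
    · rw [hcoeff, if_neg (by omega), if_neg (c := j = 0) (by omega),
        if_neg (c := j = d) (by omega), add_zero, ite_self, add_zero]
  have htop : (P.coeff d).coeff h ≠ 0 := by
    rw [hcoeff, if_neg (by omega), if_pos rfl, if_neg (by omega), if_pos rfl, zero_add, zero_add]
    exact one_ne_zero
  refine ⟨_, by rw [hP]; exact irreducible_X_add_pow_mul hd hh, ?_, ?_⟩
  · rw [hP]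
    exact not_lt.mp fun H => htop (natDegree_le_iff_coeff_coeff.mp le_rfl h d H)
  · rw [hP]
    exact not_lt.mp fun H => htop (polyHeight_le_iff.mp le_rfl h d H)

theorem exists_isZariskiOpen_subset_irreducible (k : Type*) [Field k] {d h : ℕ} (hd : 1 ≤ d)
    (hh : 1 ≤ h) : ∃ U : Set (CoeffSpace d h k), IsZariskiOpen U ∧ U.Nonempty ∧
      U ⊆ {a | Irreducible (polyOf a)} := by
  refine ⟨noRelationLocus k d h d (h + 1) ∩ noRelationLocus k d h (d + 1) h,
    (isZariskiOpen_noRelationLocus ..).inter (isZariskiOpen_noRelationLocus ..), ?_, fun a ha =>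
    irreducible_polyOf_of_mem_noRelationLocus (natDegree_polyOf_le hd a) (polyHeight_polyOf_le a)
      ha.1 ha.2⟩
  obtain ⟨a, ha, had, hah⟩ := exists_irreducible_polyOf (k := k) hd hh
  exact ⟨a, mem_noRelationLocus_of_irreducible _ _ ha (Or.inl had),
    mem_noRelationLocus_of_irreducible _ _ ha (Or.inr hah)⟩

theorem IsZariskiOpen.preimage_coeffProj {k : Type*} [Field k] {d h d' h' : ℕ} (hd : d ≤ d')
    (hh : h ≤ h') {U : Set (CoeffSpace d h k)} (hU : IsZariskiOpen U) :
    IsZariskiOpen (coeffProj hd hh ⁻¹' U : Set (CoeffSpace d' h' k)) := by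
  refine isZariskiOpen_of_forall_exists fun a ha => ?_
  obtain ⟨q, hq, hqU⟩ := hU.exists_eval_ne_zero ha
  let ι : coeffIndex d h → coeffIndex d' h' := fun p => ⟨p.1, by
    have hp := mem_coeffIndex.mp p.2
    exact mem_coeffIndex.mpr ⟨⟨hp.1.1.trans hh, hp.1.2.trans hd⟩, hp.2⟩⟩
  have heval : ∀ b : CoeffSpace d' h' k, MvPolynomial.eval b (MvPolynomial.rename ι q) =
      MvPolynomial.eval (coeffProj hd hh b) q := fun b => MvPolynomial.eval_rename ι b q
  refine ⟨MvPolynomial.rename ι q, by rwa [heval], fun b hb => hqU _ ?_⟩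
  rwa [heval] at hb

theorem exists_isZariskiOpen_subset_irreducible_coeffProj (k : Type*) [Field k] [Infinite k]
    {d h d' h' : ℕ} (hd1 : 1 ≤ d) (hh1 : 1 ≤ h) (hd : d ≤ d') (hh : h ≤ h') :
    ∃ U : Set (CoeffSpace d' h' k), IsZariskiOpen U ∧ U.Nonempty ∧
      U ⊆ {a | Irreducible (polyOf a) ∧ Irreducible (polyOf (coeffProj hd hh a))} := by
  obtain ⟨U, hU, hU', hUs⟩ :=
    exists_isZariskiOpen_subset_irreducible k (hd1.trans hd) (hh1.trans hh)
  obtain ⟨V, hV, ⟨b, hb⟩, hVs⟩ := exists_isZariskiOpen_subset_irreducible k hd1 hh1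
  have hV' := hV.preimage_coeffProj hd hh
  refine ⟨_, hU.inter hV', hU.inter_nonempty hV' hU' ⟨coeffExt d' h' b, ?_⟩,
    fun a ha => ⟨hUs ha.1, hVs ha.2⟩⟩
  rwa [Set.mem_preimage, coeffProj_coeffExt]

theorem theorem1 (k : Type*) [Field k] [IsAlgClosed k] :
    (∀ d h : ℕ, 1 ≤ d → 1 ≤ h →
      -- the affine space, of dimension `dh + d + h - 1`, is the space of normalised polynomials
      (coeffIndex d h).card = d * h + d + h - 1 ∧
      Set.BijOn (fun a : CoeffSpace d h k => polyOf a) Set.univ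
        {P : k[X][X] | P.evalEval 0 0 = 0 ∧ (derivative P).evalEval 0 0 = 1 ∧
          polyHeight P ≤ h ∧ P.natDegree ≤ d} ∧
      -- `ψ` sends a series to its normalised minimal polynomial
      (∀ f : iftSeries k d h, IsMinimalPolynomial (f : k⟦X⟧) (polyOf (psi f))) ∧
      Function.Injective (psi : iftSeries k d h → CoeffSpace d h k) ∧
      Set.range (psi : iftSeries k d h → CoeffSpace d h k) = {a | Irreducible (polyOf a)} ∧
      IsZariskiConstructible (Set.range (psi : iftSeries k d h → CoeffSpace d h k)) ∧
      (∃ U : Set (CoeffSpace d h k), IsZariskiOpen U ∧ U.Nonempty ∧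
        U ⊆ Set.range (psi : iftSeries k d h → CoeffSpace d h k)) ∧
      -- `f_{d,h}` takes its values in `I(d,h)`, and `f_{d,h} ∘ ψ = id`
      (∀ a : CoeffSpace d h k, rootMap a ∈ iftSeries k d h) ∧
      (∀ f : iftSeries k d h, rootMap (psi f) = (f : k⟦X⟧))) ∧
    (∀ d h d' h' : ℕ, 1 ≤ d → 1 ≤ h → ∀ (hd : d ≤ d') (hh : h ≤ h'),
      -- compatibility with the inclusions
      (∀ a : CoeffSpace d h k, rootMap (coeffExt d' h' a) = rootMap a) ∧
      (∃ hI : iftSeries k d h ⊆ iftSeries k d' h', ∀ f : iftSeries k d h,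
        psi (Set.inclusion hI f) = coeffExt d' h' (psi f)) ∧
      -- compatibility with the projections
      ∃ π₁ : iftSeries k d' h' → iftSeries k d h,
        (∀ f, (π₁ f : k⟦X⟧) = rootMap (coeffProj hd hh (psi f))) ∧
        (∀ f : iftSeries k d' h', (f : k⟦X⟧) ∈ iftSeries k d h → (π₁ f : k⟦X⟧) = f) ∧
        (∀ f, psi (π₁ f) = coeffProj hd hh (psi f) ↔
          Irreducible (polyOf (coeffProj hd hh (psi f)))) ∧
        ∃ U : Set (CoeffSpace d' h' k), IsZariskiOpen U ∧ U.Nonempty ∧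
          U ⊆ psi '' {f : iftSeries k d' h' | psi (π₁ f) = coeffProj hd hh (psi f)}) := by

  refine ⟨fun d h hd hh => ?_, fun d h d' h' hd1 hh1 hd hh => ?_⟩
  · rw [range_psi hd]
    exact ⟨card_coeffIndex hd, bijOn_polyOf hd, isMinimalPolynomial_polyOf_psi, psi_injective, rfl,
      isZariskiConstructible_setOf_irreducible hd, exists_isZariskiOpen_subset_irreducible k hd hh,
      rootMap_mem_iftSeries hd, rootMap_psi⟩
  · have hI : iftSeries k d h ⊆ iftSeries k d' h' := iftSeries_subset hd hh
    let π₁ : iftSeries k d' h' → iftSeries k d h := fun f =>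
      ⟨rootMap (coeffProj hd hh (psi f)), rootMap_mem_iftSeries hd1 _⟩
    have hpsi : ∀ f, psi (π₁ f) = coeffProj hd hh (psi f) ↔
        Irreducible (polyOf (coeffProj hd hh (psi f))) := fun f => psi_eq_iff_irreducible rfl
    refine ⟨rootMap_coeffExt hd hh, ⟨hI, psi_inclusion hd hh hI⟩, π₁, fun _ => rfl, ?_, hpsi, ?_⟩
    · intro f hf
      have h1 : psi f = coeffExt d' h' (psi (⟨f, hf⟩ : iftSeries k d h)) :=
        psi_inclusion hd hh hI ⟨f, hf⟩
      change rootMap (coeffProj hd hh (psi f)) = f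
      rw [h1, coeffProj_coeffExt, rootMap_psi]
    · have : Infinite k := inferInstance
      obtain ⟨U, hU, hU', hUs⟩ :=
        exists_isZariskiOpen_subset_irreducible_coeffProj k hd1 hh1 hd hh
      refine ⟨U, hU, hU', fun a ha => ?_⟩
      obtain ⟨f, rfl⟩ := (range_psi (hd1.trans hd)).ge (hUs ha).1
      exact ⟨f, (hpsi f).mpr (hUs ha).2, rfl⟩
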